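/- Let $\mathbb D$ be the open unit disk with normalized area measure $dA=\frac1\pi r\,dr\,d\theta$, let $L^2_h$ be the closed subspace of $L^2(\mathbb D,dA)$ consisting of the complex-valued harmonic functions, and let $Q$ be the orthogonal projection of $L^2(\mathbb D,dA)$ onto $L^2_h$. For a bounded measurable function $f$ on $\mathbb D$ let $T_f:L^2_h\to L^2_h$, $T_f u=Q(fu)$, be the Toeplitz operator with symbol $f$. Functions that agree almost everywhere are identified. For a bounded radial function $\phi$ on $\mathbb D$ and an integer $p$, $e^{ip\theta}\phi$ denotes the function $re^{i\theta}\mapsto e^{ip\theta}\phi(r)$. Let $p,s$ be positive integers and let $\phi$ be a non-constant bounded radial function. Then a bounded radial function $\psi$ such that $T_{e^{is\theta}\psi}$ commutes with $T_{e^{ip\theta}\phi}$ is unique up to a multiplicative constant: if $\psi_1,\psi_2$ are bounded radial functions such that both $T_{e^{is\theta}\psi_1}$ and $T_{e^{is\theta}\psi_2}$ commute with $T_{e^{ip\theta}\phi}$, and $\psi_2\neq 0$, then $\psi_1=c\,\psi_2$ for some constant $c\in\mathbb C$. -/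

import Mathlib

open MeasureTheory Metric InnerProductSpace Filter Topology
open scoped ENNReal ComplexConjugate

/-- Normalized area measure `dA = r dr dθ / π` on the open unit disk. -/
noncomputable def diskMeasure : Measure ℂ :=
  ENNReal.ofReal Real.pi⁻¹ • (volume.restrict (ball (0 : ℂ) 1))

instance : IsFiniteMeasure (diskMeasure) := by
  unfold diskMeasure
  have : IsFiniteMeasure (volume.restrict (ball (0 : ℂ) 1)) :=
    ⟨by rw [Measure.restrict_apply_univ]; exact measure_ball_lt_top⟩
  exact Measure.smul_finite _ ENNReal.ofReal_ne_top

theorem diskMeasure_ae_mem : ∀ᵐ z ∂diskMeasure, z ∈ ball (0 : ℂ) 1 :=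
  Measure.ae_smul_measure (ae_restrict_mem measurableSet_ball) _

/-- The open annulus `a < |z| < b`. -/
def annulus (a b : ℝ) : Set ℂ := {z | a < ‖z‖ ∧ ‖z‖ < b}

theorem measurableSet_annulus (a b : ℝ) : MeasurableSet (annulus a b) :=
  (measurableSet_lt measurable_const measurable_norm).inter
    (measurableSet_lt measurable_norm measurable_const)

theorem circleAverage_poisson {h : ℂ → ℂ} (hh : HarmonicOnNhd h (ball 0 1))
    {r : ℝ} (hr1 : r < 1) {w : ℂ} (hw : ‖w‖ < r) :
    Real.circleAverage (fun z => ((herglotzRieszKernel 0 w z).re : ℂ) * h z) 0 r = h w := by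
  have hr0 : 0 < r := (norm_nonneg w).trans_lt hw
  have hsub : closedBall (0 : ℂ) r ⊆ ball 0 1 := closedBall_subset_ball hr1
  have hc : ContinuousOn h (sphere 0 |r|) := by
    have := hh.contDiffOn.continuousOn
    refine this.mono ?_
    rw [abs_of_pos hr0]
    exact sphere_subset_closedBall.trans hsub
  have hk : ContinuousOn (fun z => ((herglotzRieszKernel 0 w z).re : ℂ)) (sphere 0 |r|) := by
    rw [herglotzRieszKernel_fun_def]
    have : ∀ z ∈ sphere (0 : ℂ) |r|, z - 0 - (w - 0) ≠ 0 := by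
      intro z hz h0
      rw [abs_of_pos hr0, mem_sphere_zero_iff_norm] at hz
      have : z = w := by simpa [sub_eq_zero] using h0
      subst this
      linarith
    fun_prop (disch := assumption)
  have hi : CircleIntegrable (fun z => ((herglotzRieszKernel 0 w z).re : ℂ) * h z) 0 r :=
    (hk.mul hc).circleIntegrable'
  apply Complex.ext
  · have h1 := HarmonicOnNhd.circleAverage_re_herglotzRieszKernel_smul
      ((hh.comp_CLM Complex.reCLM).mono hsub) (w := w) (by simpa using hw)
    rw [← Complex.reCLM_apply, ← Complex.reCLM.circleAverage_comp_comm hi]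
    rw [← Complex.reCLM_apply, ← Function.comp_apply (f := Complex.reCLM) (g := h), ← h1]
    congr 1
    ext z
    simp
  · have h1 := HarmonicOnNhd.circleAverage_re_herglotzRieszKernel_smul
      ((hh.comp_CLM Complex.imCLM).mono hsub) (w := w) (by simpa using hw)
    rw [← Complex.imCLM_apply, ← Complex.imCLM.circleAverage_comp_comm hi]
    rw [← Complex.imCLM_apply, ← Function.comp_apply (f := Complex.imCLM) (g := h), ← h1]
    congr 1
    ext z
    simp

theorem setIntegral_annulus {F : ℂ → ℂ} {a b : ℝ} (ha : 0 < a)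
    (hF : ContinuousOn F {z | a ≤ ‖z‖ ∧ ‖z‖ ≤ b}) :
    ∫ z in annulus a b, F z =
      ∫ r in Set.Ioo a b, (r * (2 * Real.pi)) • Real.circleAverage F 0 r := by
  have hsymm : ∀ p : ℝ × ℝ, Complex.polarCoord.symm p = circleMap 0 p.1 p.2 := by
    intro p
    rw [Complex.polarCoord_symm_apply, circleMap, Complex.exp_mul_I]
    simp
  rw [← integral_indicator (measurableSet_annulus a b), ← Complex.integral_comp_polarCoord_symm]
  have hpt : polarCoord.target = Set.Ioi (0 : ℝ) ×ˢ Set.Ioo (-Real.pi) Real.pi := rfl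
  have hms : MeasurableSet polarCoord.target := polarCoord.open_target.measurableSet
  have e1 : ∫ p in polarCoord.target,
      p.1 • (annulus a b).indicator F (Complex.polarCoord.symm p) =
      ∫ p in Set.Ioo a b ×ˢ Set.Ioo (-Real.pi) Real.pi, p.1 • F (circleMap 0 p.1 p.2) := by
    rw [← integral_indicator hms,
      ← integral_indicator (measurableSet_Ioo.prod measurableSet_Ioo)]
    congr 1
    ext p
    by_cases hp : p ∈ Set.Ioo a b ×ˢ Set.Ioo (-Real.pi) Real.pi
    · have hp0 : 0 < p.1 := ha.trans hp.1.1
      rw [Set.indicator_of_mem hp, Set.indicator_of_mem (by rw [hpt]; exact ⟨hp0, hp.2⟩),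
        Set.indicator_of_mem, hsymm]
      rw [hsymm]
      simpa [annulus, abs_of_pos hp0] using hp.1
    · rw [Set.indicator_of_notMem hp]
      by_cases hq : p ∈ polarCoord.target
      · rw [Set.indicator_of_mem hq, Set.indicator_of_notMem, smul_zero]
        rw [hsymm]
        intro hm
        rw [hpt] at hq
        have hq0 : 0 < p.1 := hq.1
        apply hp
        refine ⟨?_, hq.2⟩
        simpa [annulus, abs_of_pos hq0] using hm
      · rw [Set.indicator_of_notMem hq]
  have hcont : ContinuousOn (fun p : ℝ × ℝ => p.1 • F (circleMap 0 p.1 p.2))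
      (Set.Icc a b ×ˢ Set.Icc (-Real.pi) Real.pi) := by
    have hcm : Continuous (fun p : ℝ × ℝ => circleMap 0 p.1 p.2) := by
      unfold circleMap; fun_prop
    refine continuousOn_fst.smul (hF.comp hcm.continuousOn ?_)
    intro p hp
    have hp0 : 0 < p.1 := ha.trans_le hp.1.1
    simpa [abs_of_pos hp0] using hp.1
  have hint : IntegrableOn (fun p : ℝ × ℝ => p.1 • F (circleMap 0 p.1 p.2))
      (Set.Ioo a b ×ˢ Set.Ioo (-Real.pi) Real.pi) (volume.prod volume) :=
    (hcont.integrableOn_compact (isCompact_Icc.prod isCompact_Icc)).mono_set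
      (Set.prod_mono Set.Ioo_subset_Icc_self Set.Ioo_subset_Icc_self)
  rw [e1, Measure.volume_eq_prod, setIntegral_prod _ hint]
  refine setIntegral_congr_fun measurableSet_Ioo fun r hr => ?_
  simp only
  rw [integral_smul, Real.circleAverage_eq_integral_add (-Real.pi),
    intervalIntegral.integral_comp_add_right (fun θ => F (circleMap 0 r θ)), smul_smul,
    ← integral_Ioc_eq_integral_Ioo, ← intervalIntegral.integral_of_le (by linarith [Real.pi_pos])]
  have : 2 * Real.pi + -Real.pi = Real.pi := by ring
  rw [this, zero_add]
  congr 1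
  have := Real.pi_pos
  field_simp

theorem setIntegral_poisson {h : ℂ → ℂ} (hh : HarmonicOnNhd h (ball 0 1))
    {a b : ℝ} (ha : 0 < a) (hab : a < b) (hb : b < 1) {w : ℂ} (hw : ‖w‖ < a) :
    ∫ z in annulus a b, ((herglotzRieszKernel 0 w z).re : ℂ) * h z =
      (Real.pi * (b ^ 2 - a ^ 2) : ℝ) • h w := by
  have hc : ContinuousOn h {z | a ≤ ‖z‖ ∧ ‖z‖ ≤ b} := by
    refine hh.contDiffOn.continuousOn.mono fun z hz => ?_
    have := hz.2
    simp; linarith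
  have hk : ContinuousOn (fun z => ((herglotzRieszKernel 0 w z).re : ℂ))
      {z | a ≤ ‖z‖ ∧ ‖z‖ ≤ b} := by
    rw [herglotzRieszKernel_fun_def]
    have : ∀ z ∈ {z : ℂ | a ≤ ‖z‖ ∧ ‖z‖ ≤ b}, z - 0 - (w - 0) ≠ 0 := by
      intro z hz h0
      have : z = w := by simpa [sub_eq_zero] using h0
      subst this
      have := hz.1
      linarith
    fun_prop (disch := assumption)
  have hkc : ContinuousOn (fun z => ((herglotzRieszKernel 0 w z).re : ℂ) * h z)
      {z | a ≤ ‖z‖ ∧ ‖z‖ ≤ b} := hk.mul hc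
  rw [setIntegral_annulus ha hkc]
  have : ∀ r ∈ Set.Ioo a b, (r * (2 * Real.pi)) • Real.circleAverage
      (fun z => ((herglotzRieszKernel 0 w z).re : ℂ) * h z) 0 r = (r * (2 * Real.pi)) • h w := by
    intro r hr
    rw [circleAverage_poisson hh (hr.2.trans hb) (hw.trans hr.1)]
  rw [setIntegral_congr_fun measurableSet_Ioo this, integral_smul_const,
    ← integral_Ioc_eq_integral_Ioo, ← intervalIntegral.integral_of_le hab.le,
    intervalIntegral.integral_mul_const, integral_id]
  congr 1
  ring

theorem norm_herglotz_le {a b : ℝ} {w z : ℂ} (hw : ‖w‖ < a) (hz : z ∈ annulus a b) :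
    ‖herglotzRieszKernel 0 w z‖ ≤ 2 * b / (a - ‖w‖) := by
  have h1 := norm_sub_norm_le z w
  have h2 := norm_add_le z w
  have h3 := hz.1
  have h4 := hz.2
  have h5 : 0 < a - ‖w‖ := by linarith
  have h6 : a - ‖w‖ ≤ ‖z - w‖ := by linarith
  have h7 : ‖z + w‖ ≤ 2 * b := by linarith
  rw [herglotzRieszKernel_def, norm_div]
  simp only [sub_zero]
  have h8 : 0 ≤ 2 * b := (norm_nonneg _).trans h7
  gcongr

theorem measurable_herglotz (w : ℂ) : Measurable fun z => herglotzRieszKernel 0 w z := by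
  rw [herglotzRieszKernel_fun_def]
  fun_prop

theorem integrableOn_herglotz {g : ℂ → ℂ} {a b : ℝ}
    (hg : IntegrableOn g (annulus a b) diskMeasure) {w : ℂ} (hw : ‖w‖ < a) :
    IntegrableOn (fun z => herglotzRieszKernel 0 w z * g z) (annulus a b) diskMeasure :=
  Integrable.bdd_mul (c := 2 * b / (a - ‖w‖)) hg (measurable_herglotz w).aestronglyMeasurable
    ((ae_restrict_iff' (measurableSet_annulus a b)).2
      (Eventually.of_forall fun _ hz => norm_herglotz_le hw hz))

theorem differentiableOn_herglotz {g : ℂ → ℂ} {a b : ℝ}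
    (hg : IntegrableOn g (annulus a b) diskMeasure) :
    DifferentiableOn ℂ (fun w => ∫ z in annulus a b, herglotzRieszKernel 0 w z * g z ∂diskMeasure)
      (ball 0 a) := by
  intro w₀ hw₀
  rw [mem_ball_zero_iff] at hw₀
  set c := (‖w₀‖ + a) / 2 with hc
  have hca : c < a := by linarith
  have hc0 : 0 < c := by linarith [norm_nonneg w₀]
  have hnhds : ball (0 : ℂ) c ∈ 𝓝 w₀ := isOpen_ball.mem_nhds (by simp; linarith)
  have hbd : ∀ z ∈ annulus a b, ∀ w ∈ ball (0 : ℂ) c, a - c ≤ ‖z - w‖ := by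
    intro z hz w hw
    have h1 := norm_sub_norm_le z w
    have h2 := hz.1
    rw [mem_ball_zero_iff] at hw
    linarith
  have hne : ∀ z ∈ annulus a b, ∀ w ∈ ball (0 : ℂ) c, z - w ≠ 0 := by
    intro z hz w hw h0
    have := hbd z hz w hw
    rw [h0, norm_zero] at this
    linarith
  have hmeas := hg.aestronglyMeasurable
  have key := hasDerivAt_integral_of_dominated_loc_of_deriv_le
    (μ := diskMeasure.restrict (annulus a b))
    (F := fun w z => herglotzRieszKernel 0 w z * g z)
    (F' := fun w z => 2 * z / (z - w) ^ 2 * g z)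
    (bound := fun z => 2 * b / (a - c) ^ 2 * ‖g z‖)
    (x₀ := w₀) hnhds
    (Eventually.of_forall fun w => (measurable_herglotz w).aestronglyMeasurable.mul hmeas)
    ?_ ?_ ?_ ?_ ?_
  · exact key.2.differentiableAt.differentiableWithinAt
  · exact integrableOn_herglotz hg hw₀
  · exact (by fun_prop : Measurable fun z : ℂ => 2 * z / (z - w₀) ^ 2).aestronglyMeasurable.mul
      hmeas
  · refine (ae_restrict_iff' (measurableSet_annulus a b)).2
      (Eventually.of_forall fun z hz w hw => ?_)
    have h1 := hbd z hz w hw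
    have := hz.1
    have := hz.2
    have : 0 < a - c := by linarith
    rw [norm_mul, norm_div, norm_mul, norm_pow]
    simp only [Complex.norm_ofNat]
    have hb0 : ‖z‖ ≤ b := hz.2.le
    have : 0 ≤ b := (norm_nonneg z).trans hb0
    gcongr
  · exact hg.norm.const_mul _
  · refine (ae_restrict_iff' (measurableSet_annulus a b)).2
      (Eventually.of_forall fun z hz w hw => ?_)
    have h0 := hne z hz w hw
    refine HasDerivAt.mul_const ?_ (g z)
    have h1 : HasDerivAt (fun w => (z + w) / (z - w))
        ((1 * (z - w) - (z + w) * (-1)) / (z - w) ^ 2) w :=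
      HasDerivAt.div ((hasDerivAt_id w).const_add z) ((hasDerivAt_id w).const_sub z) h0
    simp only [herglotzRieszKernel_def, sub_zero]
    have h2 : 2 * z / (z - w) ^ 2 = (1 * (z - w) - (z + w) * (-1)) / (z - w) ^ 2 := by ring
    rw [h2]
    exact h1

theorem harmonicOnNhd_poissonIntegral {g : ℂ → ℂ} {a b : ℝ}
    (hg : IntegrableOn g (annulus a b) diskMeasure) :
    HarmonicOnNhd
      (fun w => ∫ z in annulus a b, ((herglotzRieszKernel 0 w z).re : ℂ) * g z ∂diskMeasure)
      (ball 0 a) := by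
  have hg' : IntegrableOn (fun z => conj (g z)) (annulus a b) diskMeasure :=
    Complex.conjCLE.toContinuousLinearMap.integrable_comp hg
  have d1 := differentiableOn_herglotz hg
  have d2 := differentiableOn_herglotz hg'
  intro w hw
  have a1 := (d1.analyticAt (isOpen_ball.mem_nhds hw)).harmonicAt
  have a2 := (d2.analyticAt (isOpen_ball.mem_nhds hw)).harmonicAt_conj
  refine (harmonicAt_congr_nhds ?_).1 ((a1.add a2).const_smul (c := (1 / 2 : ℝ)))
  filter_upwards [isOpen_ball.mem_nhds hw] with v hv
  simp only [Pi.smul_apply, Pi.add_apply, Pi.conj_apply]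
  rw [← integral_conj, ← integral_add (integrableOn_herglotz hg (mem_ball_zero_iff.1 hv)), ← integral_smul]
  · congr 1
    ext z
    simp only [map_mul, Complex.conj_conj, Complex.real_smul]
    rw [← add_mul, Complex.add_conj]
    push_cast
    ring
  · exact Complex.conjCLE.toContinuousLinearMap.integrable_comp 
      (integrableOn_herglotz hg' (mem_ball_zero_iff.1 hv))

theorem setIntegral_poisson_disk {h : ℂ → ℂ} (hh : HarmonicOnNhd h (ball 0 1))
    {a b : ℝ} (ha : 0 < a) (hab : a < b) (hb : b < 1) {w : ℂ} (hw : ‖w‖ < a) :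
    ∫ z in annulus a b, ((herglotzRieszKernel 0 w z).re : ℂ) * h z ∂diskMeasure =
      (b ^ 2 - a ^ 2 : ℝ) • h w := by
  have hsub : annulus a b ⊆ ball 0 1 := fun z hz => by
    have := hz.2
    simp; linarith
  rw [diskMeasure, Measure.restrict_smul, Measure.restrict_restrict_of_subset hsub,
    integral_smul_measure, setIntegral_poisson hh ha hab hb hw,
    ENNReal.toReal_ofReal (by positivity), smul_smul, ← mul_assoc,
    inv_mul_cancel₀ Real.pi_ne_zero, one_mul]

/-- The harmonic Bergman space `L²_h`: the subspace of `L²(𝔻, dA)` of (classes of) complex-valued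
harmonic functions on the open unit disk. -/
noncomputable def harmonicBergman : Submodule ℂ (Lp ℂ 2 diskMeasure) where
  carrier := {u | ∃ h : ℂ → ℂ, HarmonicOnNhd h (ball 0 1) ∧ u =ᵐ[diskMeasure] h}
  add_mem' := by
    rintro u v ⟨h, hh, hu⟩ ⟨k, hk, hv⟩
    exact ⟨h + k, hh.add hk, (Lp.coeFn_add u v).trans (hu.add hv)⟩
  zero_mem' := ⟨0, fun z _ => analyticAt_const.harmonicAt, Lp.coeFn_zero ℂ 2 diskMeasure⟩
  smul_mem' := by
    rintro c u ⟨h, hh, hu⟩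
    refine ⟨c • h, fun z hz => ?_, (Lp.coeFn_smul c u).trans (hu.const_smul c)⟩
    exact (hh z hz).comp_CLM ((ContinuousLinearMap.mul ℂ ℂ c).restrictScalars ℝ)

theorem tendsto_setIntegral_annulus {u : ℕ → Lp ℂ 2 diskMeasure} {v : Lp ℂ 2 diskMeasure}
    (huv : Tendsto u atTop (𝓝 v)) {a b : ℝ} {w : ℂ} (hw : ‖w‖ < a) :
    Tendsto
      (fun n => ∫ z in annulus a b, ((herglotzRieszKernel 0 w z).re : ℂ) * u n z ∂diskMeasure)
      atTop
      (𝓝 (∫ z in annulus a b, ((herglotzRieszKernel 0 w z).re : ℂ) * v z ∂diskMeasure)) := by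
  have hm := measurableSet_annulus a b
  set f : ℂ → ℂ := (annulus a b).indicator fun z => ((herglotzRieszKernel 0 w z).re : ℂ) with hf
  have hfm : MemLp f 2 diskMeasure := by
    refine MemLp.of_bound (C := max (2 * b / (a - ‖w‖)) 0) ?_ (Eventually.of_forall fun z => ?_)
    · exact ((Complex.measurable_ofReal.comp
        (Complex.measurable_re.comp (measurable_herglotz w))).indicator hm).aestronglyMeasurable
    · by_cases hz : z ∈ annulus a b
      · rw [hf, Set.indicator_of_mem hz, Complex.norm_real]
        exact ((Complex.abs_re_le_norm _).trans (norm_herglotz_le hw hz)).trans (le_max_left _ _)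
      · rw [hf, Set.indicator_of_notMem hz, norm_zero]
        exact le_max_right _ _
  have key : ∀ g : Lp ℂ 2 diskMeasure, inner ℂ (hfm.toLp f) g =
      ∫ z in annulus a b, ((herglotzRieszKernel 0 w z).re : ℂ) * g z ∂diskMeasure := by
    intro g
    rw [L2.inner_def, ← integral_indicator hm]
    refine integral_congr_ae ?_
    filter_upwards [hfm.coeFn_toLp] with z hz
    rw [hz, hf]
    by_cases hz : z ∈ annulus a b
    · simp [Set.indicator_of_mem hz, mul_comm]
    · simp [Set.indicator_of_notMem hz]
  simp only [← key]
  exact tendsto_const_nhds.inner huv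

theorem isClosed_harmonicBergman : IsClosed (harmonicBergman : Set (Lp ℂ 2 diskMeasure)) := by
  refine IsSeqClosed.isClosed ?_
  intro u v hu huv
  choose h hh huh using hu
  have hint : ∀ a b : ℝ, IntegrableOn (v : ℂ → ℂ) (annulus a b) diskMeasure := fun a b =>
    ((Lp.memLp v).integrable (by norm_num)).integrableOn
  -- pointwise convergence of the harmonic representatives
  have hlim : ∀ a b : ℝ, 0 < a → a < b → b < 1 → ∀ w : ℂ, ‖w‖ < a →
      Tendsto (fun n => h n w) atTop (𝓝 ((b ^ 2 - a ^ 2 : ℝ)⁻¹ •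
        ∫ z in annulus a b, ((herglotzRieszKernel 0 w z).re : ℂ) * v z ∂diskMeasure)) := by
    intro a b ha hab hb w hw
    have h0 : (b ^ 2 - a ^ 2 : ℝ) ≠ 0 := by nlinarith
    refine ((tendsto_setIntegral_annulus huv (b := b) hw).const_smul
      (b ^ 2 - a ^ 2 : ℝ)⁻¹).congr fun n => ?_
    rw [← inv_smul_smul₀ h0 (h n w), ← setIntegral_poisson_disk (hh n) ha hab hb hw]
    congr 1
    refine integral_congr_ae (ae_restrict_of_ae ?_)
    filter_upwards [huh n] with z hz
    rw [hz]
  have hH : ∀ a b : ℝ, 0 < a → a < b → b < 1 → ∀ w : ℂ, ‖w‖ < a →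
      limUnder atTop (fun n => h n w) = (b ^ 2 - a ^ 2 : ℝ)⁻¹ •
        ∫ z in annulus a b, ((herglotzRieszKernel 0 w z).re : ℂ) * v z ∂diskMeasure :=
    fun a b ha hab hb w hw => (hlim a b ha hab hb w hw).limUnder_eq
  have hex : ∀ w ∈ ball (0 : ℂ) 1, ∃ a b : ℝ, 0 < a ∧ a < b ∧ b < 1 ∧ ‖w‖ < a := by
    intro w hw
    rw [mem_ball_zero_iff] at hw
    obtain ⟨a, h1, h2⟩ := exists_between hw
    obtain ⟨b, h3, h4⟩ := exists_between h2
    exact ⟨a, b, (norm_nonneg w).trans_lt h1, h3, h4, h1⟩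
  refine ⟨fun w => limUnder atTop fun n => h n w, fun w hw => ?_, ?_⟩
  · obtain ⟨a, b, ha, hab, hb, hwa⟩ := hex w hw
    have hP := (harmonicOnNhd_poissonIntegral (hint a b) w
      (mem_ball_zero_iff.2 hwa)).const_smul (c := (b ^ 2 - a ^ 2 : ℝ)⁻¹)
    refine (harmonicAt_congr_nhds ?_).1 hP
    filter_upwards [isOpen_ball.mem_nhds (mem_ball_zero_iff.2 hwa)] with z hz
    exact (hH a b ha hab hb z (mem_ball_zero_iff.1 hz)).symm
  · obtain ⟨ns, hns, hae⟩ := (tendstoInMeasure_of_tendsto_Lp huv).exists_seq_tendsto_ae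
    filter_upwards [hae, ae_all_iff.2 huh, diskMeasure_ae_mem] with z h1 h2 h3
    obtain ⟨a, b, ha, hab, hb, hza⟩ := hex z h3
    simp only [h2] at h1
    rw [hH a b ha hab hb z hza]
    exact tendsto_nhds_unique h1 ((hlim a b ha hab hb z hza).comp hns.tendsto_atTop)

instance : CompleteSpace harmonicBergman :=
  isClosed_harmonicBergman.completeSpace_coe

/-- The Toeplitz operator `T_f u = Q (f u)` on `L²_h` with bounded symbol `f`, where `Q` is the
orthogonal projection of `L²(𝔻, dA)` onto `L²_h`; `holderL` of the multiplication of `ℂ` is the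
pointwise product `L^∞ × L² → L²`. -/
noncomputable def toeplitz (f : ℂ → ℂ) (hf : MemLp f ∞ diskMeasure) :
    harmonicBergman →L[ℂ] harmonicBergman :=
  harmonicBergman.orthogonalProjectionOnto ∘L
    (((ContinuousLinearMap.mul ℂ ℂ).holderL diskMeasure ∞ 2 2 (hf.toLp f)) ∘L
      harmonicBergman.subtypeL)

/-- The quasihomogeneous function `r e^{iθ} ↦ e^{ipθ} φ(r)` of order `p`; the radial function `φ` is
given as a function of `r = |z|`, and only its values on `(0, 1)` matter. -/
noncomputable def quasihomogeneous (p : ℤ) (φ : ℝ → ℂ) (z : ℂ) : ℂ :=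
  Complex.exp (Complex.I * p * Complex.arg z) * φ ‖z‖

theorem quasiMeasurePreserving_norm_disk :
    Measure.QuasiMeasurePreserving (fun z : ℂ => ‖z‖) diskMeasure
      (volume.restrict (Set.Ioo (0 : ℝ) 1)) := by
  refine ⟨measurable_norm, Measure.AbsolutelyContinuous.mk fun s hs hs0 => ?_⟩
  rw [Measure.restrict_apply hs] at hs0
  rw [Measure.map_apply measurable_norm hs, diskMeasure, Measure.smul_apply,
    Measure.restrict_apply (measurable_norm hs), smul_eq_mul, mul_eq_zero]
  right
  have hm : MeasurableSet ((fun z : ℂ => ‖z‖) ⁻¹' s ∩ ball 0 1) :=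
    (measurable_norm hs).inter measurableSet_ball
  have hm2 : MeasurableSet ((s ∩ Set.Ioo (0 : ℝ) 1) ×ˢ (Set.univ : Set ℝ)) :=
    (hs.inter measurableSet_Ioo).prod .univ
  rw [← lintegral_indicator_one hm, ← Complex.lintegral_comp_polarCoord_symm]
  refine lintegral_eq_zero_of_ae_eq_zero ?_
  have hnull : volume ((s ∩ Set.Ioo (0 : ℝ) 1) ×ˢ (Set.univ : Set ℝ)) = 0 := by
    rw [Measure.volume_eq_prod, Measure.prod_prod, hs0, zero_mul]
  filter_upwards [ae_restrict_mem polarCoord.open_target.measurableSet,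
    ae_restrict_of_ae (measure_eq_zero_iff_ae_notMem.1 hnull)] with p hp hps
  have hp0 : 0 < p.1 := hp.1
  rw [Set.indicator_of_notMem]
  · simp
  · rintro ⟨h1, h2⟩
    simp only [Set.mem_preimage, mem_ball_zero_iff, Complex.norm_polarCoord_symm,
      abs_of_pos hp0] at h1 h2
    exact hps ⟨⟨h1, hp0, h2⟩, trivial⟩

theorem memLp_quasihomogeneous (p : ℤ) {φ : ℝ → ℂ}
    (hφ : MemLp φ ∞ (volume.restrict (Set.Ioo (0 : ℝ) 1))) :
    MemLp (quasihomogeneous p φ) ∞ diskMeasure := by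
  have h1 : AEStronglyMeasurable (fun z : ℂ => φ ‖z‖) diskMeasure :=
    hφ.1.comp_quasiMeasurePreserving quasiMeasurePreserving_norm_disk
  have h2 : Measurable fun z : ℂ => Complex.exp (Complex.I * p * Complex.arg z) := by
    fun_prop
  refine memLp_top_of_bound (h2.aestronglyMeasurable.mul h1)
    (eLpNormEssSup φ (volume.restrict (Set.Ioo (0 : ℝ) 1))).toReal ?_
  have h3 := quasiMeasurePreserving_norm_disk.ae
    (enorm_ae_le_eLpNormEssSup φ (volume.restrict (Set.Ioo (0 : ℝ) 1)))
  filter_upwards [h3] with z hz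
  have h4 : eLpNormEssSup φ (volume.restrict (Set.Ioo (0 : ℝ) 1)) ≠ ∞ := by
    have := hφ.2
    rw [eLpNorm_exponent_top] at this
    exact this.ne
  have h5 : ‖Complex.exp (Complex.I * p * Complex.arg z)‖ = 1 := by
    rw [show Complex.I * (p : ℂ) * Complex.arg z = ((p * Complex.arg z : ℝ) : ℂ) * Complex.I by
      push_cast; ring]
    exact Complex.norm_exp_ofReal_mul_I _
  rw [quasihomogeneous, norm_mul, h5, one_mul, ← toReal_enorm]
  exact ENNReal.toReal_mono h4 hz

/-! Write F(ζ) = ∫₀¹ r^ζ f(r) dr for the transform of f, analytic in Re ζ > 0. A Toeplitz operator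
whose symbol is quasihomogeneous of positive order is a weighted shift on the powers of z, with
weights given by transforms (`toeplitz_bergmanMonomial`). Commutation on z^n is therefore a relation
between moments of φ and ψ (`powerMoment_relation_of_commute`). Put u = r^p φ and gᵢ = r^s ψᵢ, with
transforms U and Gᵢ. Eliminating the second moment of φ between the relations for ψ₁ and ψ₂ gives
U(ζ) · (G₁(ζ + 2p) G₂(ζ) - G₂(ζ + 2p) G₁(ζ)) = 0 at every ζ = 2n + 1.

A product of three transforms is an integral of (xyw)^ζ over the unit cube, so vanishing at the odd
integers propagates to the whole half-plane by Weierstrass approximation and the identity theorem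
(`powerMoment_mul_sub_eq_zero`). Analytic functions on a connected set have no zero divisors, and U
≡ 0 would make φ zero, hence constant. So the second factor vanishes: G₁/G₂ has period 2p. Starting
from a point m with G₂(m) ≠ 0, some g₁ - c g₂ then has zero moments along an arithmetic progression
of exponents, which forces it to vanish (`ae_eq_const_mul_of_powerMoment_periodic`). -/

/-! ### Vanishing moments and the Mellin-type transform on (0, 1) -/

/-- Weierstrass approximation on [0, 1]: h is a uniform limit of polynomials, and Φ is integrable.
The space X is left abstract because the lemma serves both the interval, with T = r^d, and the cube,
with T the squared product of the coordinates. -/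
theorem integral_mul_comp_eq_zero_of_moments {X : Type*} [MeasurableSpace X] {μ : Measure X}
    {Φ : X → ℂ} (hΦ : Integrable Φ μ) {T : X → ℝ} (hT : AEStronglyMeasurable T μ)
    (hT1 : ∀ᵐ x ∂μ, T x ∈ Set.Icc (0 : ℝ) 1)
    (h0 : ∀ n : ℕ, ∫ x, ((T x ^ n : ℝ) : ℂ) * Φ x ∂μ = 0) {h : ℝ → ℝ} (hh : Continuous h) :
    ∫ x, (h (T x) : ℂ) * Φ x ∂μ = 0 := by
  have hint : ∀ g : ℝ → ℝ, Continuous g → Integrable (fun x => (g (T x) : ℂ) * Φ x) μ := by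
    intro g hg
    obtain ⟨C, hC⟩ := isCompact_Icc.exists_bound_of_continuousOn
      (hg.continuousOn (s := Set.Icc (0 : ℝ) 1))
    refine hΦ.bdd_mul (c := C) ?_ ?_
    · exact (Complex.continuous_ofReal.comp hg).comp_aestronglyMeasurable hT
    · filter_upwards [hT1] with x hx
      rw [Complex.norm_real]
      exact hC _ hx
  have hpoly : ∀ P : Polynomial ℝ, ∫ x, ((P.eval (T x) : ℝ) : ℂ) * Φ x ∂μ = 0 := by
    intro P
    induction P using Polynomial.induction_on' with
    | add P Q hP hQ =>
      simp only [Polynomial.eval_add, Complex.ofReal_add, add_mul]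
      rw [integral_add (hint _ P.continuous) (hint _ Q.continuous), hP, hQ, add_zero]
    | monomial n a =>
      simp only [Polynomial.eval_monomial, Complex.ofReal_mul a, mul_assoc]
      rw [integral_const_mul, h0, mul_zero]
  refine norm_le_zero_iff.1 (le_of_forall_pos_le_add fun ε hε => ?_)
  rw [zero_add]
  have hK : 0 ≤ ∫ x, ‖Φ x‖ ∂μ := integral_nonneg fun _ => norm_nonneg _
  -- The summand 1 keeps the denominator positive even when Φ = 0.
  obtain ⟨P, hP⟩ := exists_polynomial_near_of_continuousOn 0 1 h hh.continuousOn
    (ε / (∫ x, ‖Φ x‖ ∂μ + 1)) (by positivity)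
  calc ‖∫ x, (h (T x) : ℂ) * Φ x ∂μ‖
      = ‖∫ x, ((h (T x) : ℂ) * Φ x - ((P.eval (T x) : ℝ) : ℂ) * Φ x) ∂μ‖ := by
        rw [integral_sub (hint _ hh) (hint _ P.continuous), hpoly, sub_zero]
    _ ≤ ∫ x, ε / (∫ x, ‖Φ x‖ ∂μ + 1) * ‖Φ x‖ ∂μ := by
        refine norm_integral_le_of_norm_le (hΦ.norm.const_mul _) ?_
        filter_upwards [hT1] with x hx
        rw [← sub_mul, norm_mul, ← Complex.ofReal_sub, Complex.norm_real, Real.norm_eq_abs,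
          abs_sub_comm]
        gcongr
        exact (hP _ hx).le
    _ ≤ ε := by
        rw [integral_const_mul, div_mul_eq_mul_div, div_le_iff₀ (by positivity)]
        nlinarith

/-- The Mellin-type transform `ζ ↦ ∫₀¹ r ^ ζ f(r) dr`. -/
noncomputable def powerMoment (f : ℝ → ℂ) (ζ : ℂ) : ℂ :=
  ∫ r in Set.Ioo (0 : ℝ) 1, (r : ℂ) ^ ζ * f r

theorem norm_cpow_le_one {r : ℝ} (hr : r ∈ Set.Ioo (0 : ℝ) 1) {ζ : ℂ} (hζ : 0 ≤ ζ.re) :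
    ‖(r : ℂ) ^ ζ‖ ≤ 1 := by
  rw [Complex.norm_cpow_eq_rpow_re_of_pos hr.1]
  exact Real.rpow_le_one hr.1.le hr.2.le hζ

theorem measurable_ofReal_cpow (ζ : ℂ) : Measurable fun r : ℝ => (r : ℂ) ^ ζ := by fun_prop

theorem integrable_cpow_mul {f : ℝ → ℂ} (hf : IntegrableOn f (Set.Ioo 0 1)) {ζ : ℂ}
    (hζ : 0 ≤ ζ.re) : IntegrableOn (fun r : ℝ => (r : ℂ) ^ ζ * f r) (Set.Ioo 0 1) :=
  Integrable.bdd_mul (c := 1) hf (measurable_ofReal_cpow ζ).aestronglyMeasurable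
    ((ae_restrict_iff' measurableSet_Ioo).2
      (Eventually.of_forall fun _ hr => norm_cpow_le_one hr hζ))

theorem differentiableAt_powerMoment {f : ℝ → ℂ} (hf : IntegrableOn f (Set.Ioo 0 1)) {ζ₀ : ℂ}
    (hζ₀ : 0 < ζ₀.re) : DifferentiableAt ℂ (powerMoment f) ζ₀ := by
  -- On the half-plane Re ζ > δ the derivative of r^ζ is dominated uniformly: |log r| r^(Re ζ) ≤
  -- |log r| r^δ ≤ 1/δ.
  set δ := ζ₀.re / 2 with hδ
  have hδ0 : 0 < δ := by positivity
  have hnhds : {ζ : ℂ | δ < ζ.re} ∈ 𝓝 ζ₀ :=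
    (isOpen_lt continuous_const Complex.continuous_re).mem_nhds (by simp; linarith)
  have key := hasDerivAt_integral_of_dominated_loc_of_deriv_le
    (μ := volume.restrict (Set.Ioo (0 : ℝ) 1))
    (F := fun ζ r => (r : ℂ) ^ ζ * f r)
    (F' := fun ζ r => (r : ℂ) ^ ζ * Complex.log r * f r)
    (bound := fun r => 1 / δ * ‖f r‖) (x₀ := ζ₀) hnhds
    (Eventually.of_forall fun ζ =>
      (measurable_ofReal_cpow ζ).aestronglyMeasurable.mul hf.aestronglyMeasurable)
    (integrable_cpow_mul hf hζ₀.le)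
    ((by fun_prop : Measurable fun r : ℝ =>
      (r : ℂ) ^ ζ₀ * Complex.log r).aestronglyMeasurable.mul hf.aestronglyMeasurable)
    ?_ (hf.norm.const_mul _) ?_
  · exact key.2.differentiableAt
  · refine (ae_restrict_iff' measurableSet_Ioo).2 (Eventually.of_forall fun r hr ζ hζ => ?_)
    have h1 := Real.abs_log_mul_self_rpow_lt r δ hr.1 hr.2.le hδ0
    have h2 : r ^ ζ.re ≤ r ^ δ :=
      Real.rpow_le_rpow_of_exponent_ge hr.1 hr.2.le (le_of_lt hζ)
    rw [norm_mul, norm_mul, Complex.norm_cpow_eq_rpow_re_of_pos hr.1, ← Complex.ofReal_log hr.1.le,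
      Complex.norm_real, Real.norm_eq_abs]
    gcongr
    rw [abs_mul, abs_of_nonneg (Real.rpow_nonneg hr.1.le _)] at h1
    nlinarith [abs_nonneg (Real.log r)]
  · refine (ae_restrict_iff' measurableSet_Ioo).2 (Eventually.of_forall fun r hr ζ hζ => ?_)
    have hr0 : (r : ℂ) ≠ 0 := Complex.ofReal_ne_zero.2 hr.1.ne'
    refine HasDerivAt.mul_const ?_ (f r)
    simpa using (hasDerivAt_id ζ).const_cpow (c := (r : ℂ)) (Or.inl hr0)

theorem powerMoment_natCast (f : ℝ → ℂ) (n : ℕ) :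
    powerMoment f n = ∫ r in Set.Ioo (0 : ℝ) 1, ((r ^ n : ℝ) : ℂ) * f r := by
  simp [powerMoment]

/-- An easy case of Müntz's theorem: polynomials in r^d are uniformly dense in the continuous
functions on [0, 1], since r ↦ r^d is a homeomorphism there. So r^m f is orthogonal to every
continuous function, and r^m has no zero in (0, 1). -/
theorem ae_eq_zero_of_powerMoment_eq_zero {f : ℝ → ℂ} (hf : IntegrableOn f (Set.Ioo 0 1))
    {m d : ℕ} (hd : 0 < d) (h : ∀ k : ℕ, powerMoment f ((m + d * k : ℕ) : ℂ) = 0) :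
    f =ᵐ[volume.restrict (Set.Ioo (0 : ℝ) 1)] 0 := by
  have hmem := ae_restrict_mem (μ := (volume : Measure ℝ)) (measurableSet_Ioo (a := (0:ℝ)) (b := 1))
  set Φ : ℝ → ℂ := fun r => ((r ^ m : ℝ) : ℂ) * f r with hΦdef
  have hΦ : IntegrableOn Φ (Set.Ioo 0 1) := by
    have := integrable_cpow_mul hf (ζ := (m : ℂ)) (by simp)
    simpa [hΦdef] using this
  have h1 : ∀ g : ℝ → ℝ, Continuous g → ∫ r in Set.Ioo (0 : ℝ) 1, (g r : ℂ) * Φ r = 0 := by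
    intro g hg
    have hd' : (0 : ℝ) ≤ (d : ℝ)⁻¹ := by positivity
    have := integral_mul_comp_eq_zero_of_moments (μ := volume.restrict (Set.Ioo (0 : ℝ) 1)) hΦ
      (T := fun r => r ^ d) (by fun_prop) ?_ ?_
      (h := fun t => g (t ^ (d : ℝ)⁻¹)) (hg.comp (Real.continuous_rpow_const hd'))
    · rw [← this]
      refine setIntegral_congr_fun measurableSet_Ioo fun r hr => ?_
      rw [Real.pow_rpow_inv_natCast hr.1.le hd.ne']
    · filter_upwards [hmem] with r hr
      exact ⟨pow_nonneg hr.1.le _, pow_le_one₀ hr.1.le hr.2.le⟩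
    · intro n
      rw [← h n, powerMoment_natCast]
      refine setIntegral_congr_fun measurableSet_Ioo fun r hr => ?_
      simp only [hΦdef]
      push_cast
      ring
  have h2 := (isOpen_Ioo (a := (0 : ℝ)) (b := 1)).ae_eq_zero_of_integral_contDiff_smul_eq_zero
    (μ := volume.restrict (Set.Ioo (0 : ℝ) 1)) (f := Φ)
    ((Integrable.locallyIntegrable hΦ).locallyIntegrableOn _)
    (fun g hg _ _ => by simpa using h1 g hg.continuous)
  filter_upwards [h2, hmem] with r hr hr1
  have := hr hr1
  simp only [hΦdef, mul_eq_zero, Complex.ofReal_eq_zero] at this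
  rcases this with h3 | h3
  · exact absurd h3 (pow_pos hr1.1 _).ne'
  · exact h3

theorem analyticOnNhd_powerMoment {f : ℝ → ℂ} (hf : IntegrableOn f (Set.Ioo 0 1)) :
    AnalyticOnNhd ℂ (powerMoment f) {ζ | 0 < ζ.re} :=
  DifferentiableOn.analyticOnNhd
    (fun _ hζ => (differentiableAt_powerMoment hf hζ).differentiableWithinAt)
    (isOpen_lt continuous_const Complex.continuous_re)

theorem isPreconnected_re_pos : IsPreconnected {ζ : ℂ | 0 < ζ.re} :=
  (convex_halfSpace_re_gt 0).isPreconnected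

theorem powerMoment_pow_mul (f : ℝ → ℂ) (n : ℕ) (ζ : ℂ) :
    powerMoment (fun r => (r : ℂ) ^ n * f r) ζ = powerMoment f (ζ + n) := by
  refine setIntegral_congr_fun measurableSet_Ioo fun r hr => ?_
  have hr0 : (r : ℂ) ≠ 0 := Complex.ofReal_ne_zero.2 hr.1.ne'
  simp only [Complex.cpow_add _ _ hr0, Complex.cpow_natCast]
  ring

theorem integrableOn_pow_mul {f : ℝ → ℂ} (hf : IntegrableOn f (Set.Ioo 0 1)) (n : ℕ) :
    IntegrableOn (fun r : ℝ => (r : ℂ) ^ n * f r) (Set.Ioo 0 1) := by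
  simpa using integrable_cpow_mul hf (ζ := (n : ℂ)) (by simp)

/-- A combination of products of three moments that vanishes at the odd integers vanishes. -/
theorem powerMoment_mul_sub_eq_zero {u v₁ w₁ v₂ w₂ : ℝ → ℂ}
    (hu : IntegrableOn u (Set.Ioo 0 1)) (hv₁ : IntegrableOn v₁ (Set.Ioo 0 1))
    (hw₁ : IntegrableOn w₁ (Set.Ioo 0 1)) (hv₂ : IntegrableOn v₂ (Set.Ioo 0 1))
    (hw₂ : IntegrableOn w₂ (Set.Ioo 0 1))
    (h : ∀ n : ℕ, powerMoment u ((2 * n + 1 : ℕ) : ℂ) *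
      (powerMoment v₁ ((2 * n + 1 : ℕ) : ℂ) * powerMoment w₂ ((2 * n + 1 : ℕ) : ℂ) -
        powerMoment v₂ ((2 * n + 1 : ℕ) : ℂ) * powerMoment w₁ ((2 * n + 1 : ℕ) : ℂ)) = 0)
    {ζ : ℂ} (hζ : 0 < ζ.re) :
    powerMoment u ζ * (powerMoment v₁ ζ * powerMoment w₂ ζ -
      powerMoment v₂ ζ * powerMoment w₁ ζ) = 0 := by
  set ν : Measure ℝ := volume.restrict (Set.Ioo (0 : ℝ) 1) with hν
  -- By Fubini the expression at a real exponent a ≥ 0 is the integral of S^a Φ over the cube: a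
  -- single moment problem in the variable S.
  set Φ : ℝ × ℝ × ℝ → ℂ := fun q => u q.1 * (v₁ q.2.1 * w₂ q.2.2 - v₂ q.2.1 * w₁ q.2.2) with hΦdef
  set S : ℝ × ℝ × ℝ → ℝ := fun q => q.1 * (q.2.1 * q.2.2) with hS
  have hΦ : Integrable Φ (ν.prod (ν.prod ν)) :=
    Integrable.mul_prod hu ((Integrable.mul_prod hv₁ hw₂).sub (Integrable.mul_prod hv₂ hw₁))
  have hmem : ∀ᵐ q ∂(ν.prod (ν.prod ν)), q ∈ Set.Ioo (0 : ℝ) 1 ×ˢ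
      (Set.Ioo (0 : ℝ) 1 ×ˢ Set.Ioo (0 : ℝ) 1) := by
    rw [hν, Measure.prod_restrict, Measure.prod_restrict]
    exact ae_restrict_mem (measurableSet_Ioo.prod (measurableSet_Ioo.prod measurableSet_Ioo))
  have hS01 : ∀ q ∈ Set.Ioo (0 : ℝ) 1 ×ˢ (Set.Ioo (0 : ℝ) 1 ×ˢ Set.Ioo (0 : ℝ) 1),
      0 < S q ∧ S q ≤ 1 := by
    rintro ⟨x, y, w⟩ ⟨hx, hy, hw⟩
    simp only at hx hy hw
    have h1 : 0 < y * w := mul_pos hy.1 hw.1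
    have h2 : y * w ≤ 1 := mul_le_one₀ hy.2.le hw.1.le hw.2.le
    exact ⟨mul_pos hx.1 h1, mul_le_one₀ hx.2.le h1.le h2⟩
  have hJ : ∀ a : ℝ, 0 ≤ a → ∫ q, ((S q ^ a : ℝ) : ℂ) * Φ q ∂(ν.prod (ν.prod ν)) =
      powerMoment u a * (powerMoment v₁ a * powerMoment w₂ a -
        powerMoment v₂ a * powerMoment w₁ a) := by
    intro a ha
    have hi : ∀ f : ℝ → ℂ, IntegrableOn f (Set.Ioo 0 1) →
        Integrable (fun r : ℝ => (r : ℂ) ^ (a : ℂ) * f r) ν :=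
      fun f hf => integrable_cpow_mul hf (by simpa using ha)
    simp only [powerMoment]
    rw [← integral_prod_mul, ← integral_prod_mul, ← integral_sub
      (Integrable.mul_prod (hi _ hv₁) (hi _ hw₂)) (Integrable.mul_prod (hi _ hv₂) (hi _ hw₁)),
      ← integral_prod_mul (μ := ν) (ν := ν.prod ν)
        (fun x : ℝ => (x : ℂ) ^ (a : ℂ) * u x)
        (fun q : ℝ × ℝ => (q.1 : ℂ) ^ (a : ℂ) * v₁ q.1 * ((q.2 : ℂ) ^ (a : ℂ) * w₂ q.2) -
          (q.1 : ℂ) ^ (a : ℂ) * v₂ q.1 * ((q.2 : ℂ) ^ (a : ℂ) * w₁ q.2))]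
    refine integral_congr_ae ?_
    filter_upwards [hmem] with q hq
    obtain ⟨hx, hy, hw⟩ := hq
    simp only [hS, hΦdef]
    rw [Real.mul_rpow hx.1.le (mul_pos hy.1 hw.1).le, Real.mul_rpow hy.1.le hw.1.le]
    simp only [Complex.ofReal_mul, Complex.ofReal_cpow hx.1.le, Complex.ofReal_cpow hy.1.le,
      Complex.ofReal_cpow hw.1.le]
    ring
  have hreal : ∀ t : ℝ, 0 ≤ t → powerMoment u ((1 + 2 * t : ℝ) : ℂ) *
      (powerMoment v₁ ((1 + 2 * t : ℝ) : ℂ) * powerMoment w₂ ((1 + 2 * t : ℝ) : ℂ) -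
        powerMoment v₂ ((1 + 2 * t : ℝ) : ℂ) * powerMoment w₁ ((1 + 2 * t : ℝ) : ℂ)) = 0 := by
    intro t ht
    have hSc : Continuous S := by fun_prop
    -- The odd moments of Φ in S are all the moments of S Φ in S². Testing against x^t reaches every
    -- real exponent 1 + 2t ≥ 1.
    have key := integral_mul_comp_eq_zero_of_moments (μ := ν.prod (ν.prod ν))
      (Φ := fun q => (S q : ℂ) * Φ q) (T := fun q => S q ^ 2) (h := fun x => x ^ t)
      ?_ (hSc.pow 2).aestronglyMeasurable ?_ ?_ (Real.continuous_rpow_const ht)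
    · rw [← hJ _ (by positivity), ← key]
      refine integral_congr_ae ?_
      filter_upwards [hmem] with q hq
      have h0 := (hS01 q hq).1
      rw [Real.rpow_add h0, Real.rpow_mul h0.le, Real.rpow_one, Real.rpow_two]
      push_cast
      ring
    · refine hΦ.bdd_mul (c := 1)
        (Complex.continuous_ofReal.comp hSc).aestronglyMeasurable ?_
      filter_upwards [hmem] with q hq
      have := hS01 q hq
      rw [Complex.norm_real, Real.norm_eq_abs, abs_of_pos this.1]
      exact this.2
    · filter_upwards [hmem] with q hq
      have := hS01 q hq
      exact ⟨by positivity, pow_le_one₀ this.1.le this.2⟩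
    · intro n
      have h1 := h n
      have h2 : ((2 * n + 1 : ℕ) : ℂ) = ((2 * n + 1 : ℝ) : ℂ) := by push_cast; ring
      rw [h2, ← hJ _ (by positivity)] at h1
      rw [← h1]
      refine integral_congr_ae ?_
      filter_upwards [hmem] with q hq
      have h0 := (hS01 q hq).1
      have h3 : S q ^ (2 * n + 1 : ℝ) = (S q ^ 2) ^ n * S q := by
        rw [Real.rpow_add h0, Real.rpow_one, Real.rpow_mul h0.le, Real.rpow_two,
          Real.rpow_natCast]
      rw [h3]
      push_cast
      ring
  have han := (analyticOnNhd_powerMoment hu).mul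
    (((analyticOnNhd_powerMoment hv₁).mul (analyticOnNhd_powerMoment hw₂)).sub
      ((analyticOnNhd_powerMoment hv₂).mul (analyticOnNhd_powerMoment hw₁)))
  -- Any real point of [1, ∞) would do in place of 2: zeros accumulate at it from the right.
  refine han.eqOn_zero_of_preconnected_of_frequently_eq_zero isPreconnected_re_pos
    (z₀ := ((2 : ℝ) : ℂ)) (by simp) ?_ hζ
  have htend : Tendsto (fun r : ℝ => (r : ℂ)) (𝓝[>] 2) (𝓝[≠] ((2 : ℝ) : ℂ)) := by
    refine tendsto_nhdsWithin_iff.2 ⟨?_, ?_⟩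
    · exact Complex.continuous_ofReal.continuousAt.tendsto.mono_left nhdsWithin_le_nhds
    · filter_upwards [self_mem_nhdsWithin] with r hr
      have hr2 : (2 : ℝ) < r := hr
      exact fun h0 => hr2.ne' (Complex.ofReal_injective h0)
  refine htend.frequently (Eventually.frequently ?_)
  filter_upwards [self_mem_nhdsWithin] with r hr
  have hr2 : (2 : ℝ) < r := hr
  have := hreal ((r - 1) / 2) (by linarith)
  rw [show 1 + 2 * ((r - 1) / 2) = r by ring] at this
  exact this

/-- If the quotient of two transforms is periodic, then the functions are proportional. -/
theorem ae_eq_const_mul_of_powerMoment_periodic {f g : ℝ → ℂ}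
    (hf : IntegrableOn f (Set.Ioo 0 1)) (hg : IntegrableOn g (Set.Ioo 0 1)) {d : ℕ} (hd : 0 < d)
    (h : ∀ ζ : ℂ, 0 < ζ.re →
      powerMoment f (ζ + d) * powerMoment g ζ = powerMoment g (ζ + d) * powerMoment f ζ)
    (hg0 : ¬ g =ᵐ[volume.restrict (Set.Ioo (0 : ℝ) 1)] 0) :
    ∃ c : ℂ, f =ᵐ[volume.restrict (Set.Ioo (0 : ℝ) 1)] fun r => c * g r := by
  obtain ⟨k₀, hk₀⟩ : ∃ k : ℕ, powerMoment g ((1 + 1 * k : ℕ) : ℂ) ≠ 0 := by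
    by_contra! hcon
    exact hg0 (ae_eq_zero_of_powerMoment_eq_zero hg one_pos hcon)
  set m := 1 + 1 * k₀ with hm
  have hm0 : (0 : ℝ) < ((m : ℕ) : ℂ).re := by rw [Complex.natCast_re, hm]; positivity
  have hiter : ∀ k : ℕ, ∀ ζ : ℂ, 0 < ζ.re → powerMoment f (ζ + (d * k : ℕ)) * powerMoment g ζ -
      powerMoment g (ζ + (d * k : ℕ)) * powerMoment f ζ = 0 := by
    intro k
    induction k with
    | zero => intro ζ _; simp [mul_comm]
    | succ k ih =>
      have hshift : ∀ a : ℂ, 0 ≤ a.re → ∀ u : ℝ → ℂ, IntegrableOn u (Set.Ioo 0 1) →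
          AnalyticOnNhd ℂ (fun ζ => powerMoment u (ζ + a)) {ζ | 0 < ζ.re} := by
        intro a ha u hu
        refine DifferentiableOn.analyticOnNhd (fun ζ hζ => ?_)
          (isOpen_lt continuous_const Complex.continuous_re)
        have hζ' : 0 < ζ.re := hζ
        have h1 : 0 < (ζ + a).re := by rw [Complex.add_re]; linarith
        exact (DifferentiableAt.comp (f := fun ζ => ζ + a) ζ (differentiableAt_powerMoment hu h1)
          (by fun_prop)).differentiableWithinAt
      have hz : (0 : ℝ) ≤ (0 : ℂ).re := le_rfl
      have hk : (0 : ℝ) ≤ ((d * k : ℕ) : ℂ).re := by rw [Complex.natCast_re]; positivity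
      have hk1 : (0 : ℝ) ≤ ((d * (k + 1) : ℕ) : ℂ).re := by rw [Complex.natCast_re]; positivity
      have h0 := hshift 0 hz
      simp only [add_zero] at h0
      -- Dividing by the transform of g at ζ + dk is not allowed, as it may vanish there. It is kept
      -- as a factor and discarded afterwards, because it cannot vanish identically.
      have hmul : ∀ ζ ∈ {ζ : ℂ | 0 < ζ.re}, powerMoment g (ζ + (d * k : ℕ)) *
          (powerMoment f (ζ + (d * (k + 1) : ℕ)) * powerMoment g ζ -
            powerMoment g (ζ + (d * (k + 1) : ℕ)) * powerMoment f ζ) = 0 := by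
        intro ζ hζ
        have hζ' : 0 < ζ.re := hζ
        have e1 := ih ζ hζ
        have e2 := h (ζ + (d * k : ℕ)) (by rw [Complex.add_re]; linarith)
        have e3 : ζ + ((d * (k + 1) : ℕ) : ℂ) = ζ + (d * k : ℕ) + d := by push_cast; ring
        rw [e3]
        linear_combination powerMoment g ζ * e2 + powerMoment g (ζ + (d * k : ℕ) + d) * e1
      rcases (hshift _ hk g hg).eq_zero_or_eq_zero_of_mul_eq_zero
        (((hshift _ hk1 f hf).mul (h0 g hg)).sub ((hshift _ hk1 g hg).mul (h0 f hf)))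
        hmul isPreconnected_re_pos with h1 | h1
      · exfalso
        apply hg0
        refine ae_eq_zero_of_powerMoment_eq_zero (m := 1 + d * k) (d := 1) hg one_pos fun j => ?_
        have := h1 ((1 + j : ℕ) : ℂ) (by
          rw [Set.mem_ofPred_eq, Complex.natCast_re]; positivity)
        rw [← this]
        congr 1
        push_cast
        ring
      · exact h1
  -- The constant is the value of the periodic quotient at m, so the moments of f - c g vanish at
  -- every m + dk.
  refine ⟨powerMoment f m / powerMoment g m, ?_⟩
  set c := powerMoment f m / powerMoment g m with hc
  have hz := ae_eq_zero_of_powerMoment_eq_zero (f := fun r => f r - c * g r) (m := m) (d := d)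
    (hf.sub (hg.const_mul c)) hd fun k => ?_
  · filter_upwards [hz] with r hr
    exact sub_eq_zero.1 hr
  · have h1 := hiter k m hm0
    have h2 : powerMoment (fun r => f r - c * g r) ((m + d * k : ℕ) : ℂ) =
        powerMoment f ((m + d * k : ℕ) : ℂ) - c * powerMoment g ((m + d * k : ℕ) : ℂ) := by
      have hre : (0 : ℝ) ≤ ((m + d * k : ℕ) : ℂ).re := by rw [Complex.natCast_re]; positivity
      simp only [powerMoment]
      rw [← integral_const_mul, ← integral_sub (integrable_cpow_mul hf hre)
        ((integrable_cpow_mul hg hre).const_mul c)]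
      congr 1
      ext r
      ring
    rw [h2, hc, div_mul_eq_mul_div, sub_eq_zero, eq_div_iff hk₀]
    push_cast at h1 ⊢
    linear_combination h1

/-! ### Fourier coefficients of harmonic functions on circles -/

/-- With F₁, F₂ analytic and Re F₁ = Re h, Re F₂ = Im h, expand h = Re F₁ + i Re F₂ and collect the
analytic and the antianalytic terms. -/
theorem exists_analyticOnNhd_add_conj {h : ℂ → ℂ} (hh : HarmonicOnNhd h (ball 0 1)) :
    ∃ G H : ℂ → ℂ, AnalyticOnNhd ℂ G (ball 0 1) ∧ AnalyticOnNhd ℂ H (ball 0 1) ∧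
      ∀ z ∈ ball (0 : ℂ) 1, h z = G z + conj (H z) := by
  obtain ⟨F₁, hF₁, h₁⟩ := (hh.comp_CLM Complex.reCLM).exists_analyticOnNhd_ball_re_eq
  obtain ⟨F₂, hF₂, h₂⟩ := (hh.comp_CLM Complex.imCLM).exists_analyticOnNhd_ball_re_eq
  refine ⟨fun z => (F₁ z + Complex.I * F₂ z) / 2, fun z => (F₁ z - Complex.I * F₂ z) / 2,
    fun z hz => ?_, fun z hz => ?_, fun z hz => ?_⟩
  · exact ((hF₁ z hz).add (analyticAt_const.mul (hF₂ z hz))).div analyticAt_const two_ne_zero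
  · exact ((hF₁ z hz).sub (analyticAt_const.mul (hF₂ z hz))).div analyticAt_const two_ne_zero
  · have e1 : (F₁ z).re = (h z).re := h₁ hz
    have e2 : (F₂ z).re = (h z).im := h₂ hz
    apply Complex.ext
    · simp [← e1, Complex.conj_ofNat]
      ring
    · simp [← e2, Complex.conj_ofNat]
      ring

/-- The angular Fourier coefficients of positive order of a harmonic function on the disk. -/
theorem exists_circleAverage_conj_pow_mul {h : ℂ → ℂ} (hh : HarmonicOnNhd h (ball 0 1)) {k : ℕ}
    (hk : k ≠ 0) : ∃ C : ℂ, ∀ r ∈ Set.Ioo (0 : ℝ) 1,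
      Real.circleAverage (fun z => conj z ^ k * h z) 0 r = (r : ℂ) ^ (2 * k) * C := by
  obtain ⟨G, H, hG, hH, hGH⟩ := exists_analyticOnNhd_add_conj hh
  -- Cauchy's theorem on an annulus: the average is a contour integral of an integrand analytic away
  -- from 0. The radius 1/2 used for C below is therefore arbitrary.
  have hindep : ∀ r R : ℝ, 0 < r → r ≤ R → R < 1 →
      Real.circleAverage (fun z => z⁻¹ ^ k * G z) 0 R =
        Real.circleAverage (fun z => z⁻¹ ^ k * G z) 0 r := by
    intro r R hr hrR hR
    rw [Real.circleAverage_eq_circleIntegral hr.ne',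
      Real.circleAverage_eq_circleIntegral (hr.trans_le hrR).ne']
    have hd : ∀ z ∈ closedBall (0 : ℂ) R \ ball 0 r,
        DifferentiableAt ℂ (fun z => z⁻¹ ^ k * G z) z := by
      rintro z ⟨hz1, hz2⟩
      have hz0 : z ≠ 0 := by
        rintro rfl
        exact hz2 (mem_ball_self hr)
      have := (hG z (closedBall_subset_ball hR hz1)).differentiableAt
      fun_prop (disch := assumption)
    rw [Complex.circleIntegral_sub_center_inv_smul_eq_of_differentiable_on_annulus_off_countable
      hr hrR Set.countable_empty]
    · exact fun z hz => (hd z hz).continuousAt.continuousWithinAt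
    · exact fun z hz => hd z ⟨ball_subset_closedBall hz.1.1,
        fun hb => hz.1.2 (ball_subset_closedBall hb)⟩
  refine ⟨Real.circleAverage (fun z => z⁻¹ ^ k * G z) 0 (1 / 2), fun r hr => ?_⟩
  have hsph : sphere (0 : ℂ) |r| ⊆ ball 0 1 := by
    rw [abs_of_pos hr.1]
    exact sphere_subset_closedBall.trans (closedBall_subset_ball hr.2)
  have hnorm : ∀ z ∈ sphere (0 : ℂ) |r|, ‖z‖ = r := fun z hz => by
    rwa [abs_of_pos hr.1, mem_sphere_zero_iff_norm] at hz
  -- Mean value property; k ≠ 0 makes the value at the centre zero, so the antianalytic part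
  -- contributes nothing.
  have hH0 : Real.circleAverage (fun z => z ^ k * H z) 0 r = 0 := by
    rw [circleAverage_of_differentiable_on_off_countable Set.countable_empty]
    · simp [hk]
    · intro z hz
      rw [abs_of_pos hr.1] at hz
      have := (hH z (closedBall_subset_ball hr.2 hz)).continuousAt
      exact ContinuousAt.continuousWithinAt (by fun_prop)
    · intro z hz
      rw [abs_of_pos hr.1] at hz
      have := (hH z (ball_subset_ball hr.2.le hz.1)).differentiableAt
      fun_prop
  have hcG : ContinuousOn (fun z => z⁻¹ ^ k * G z) (sphere 0 |r|) := by
    intro z hz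
    have hz0 : z ≠ 0 := by
      rintro rfl
      have := hnorm 0 hz
      rw [norm_zero] at this
      exact hr.1.ne this
    have := (hG z (hsph hz)).continuousAt
    exact ContinuousAt.continuousWithinAt (by fun_prop (disch := assumption))
  have hcH : ContinuousOn (fun z => z ^ k * H z) (sphere 0 |r|) := by
    intro z hz
    have := (hH z (hsph hz)).continuousAt
    exact ContinuousAt.continuousWithinAt (by fun_prop)
  -- On |z| = r one has conj z = r² / z, the source of the factor r^(2k).
  have hcong : Set.EqOn (fun z => conj z ^ k * h z)
      ((fun z => ((r : ℂ) ^ (2 * k)) • (z⁻¹ ^ k * G z)) +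
        (fun z => Complex.conjCLE (z ^ k * H z))) (sphere 0 |r|) := by
    intro z hz
    have hzr := hnorm z hz
    have hz0 : z ≠ 0 := by
      rw [← norm_pos_iff, hzr]
      exact hr.1
    have h1 : conj z = (r : ℂ) ^ 2 * z⁻¹ := by
      rw [eq_mul_inv_iff_mul_eq₀ hz0, mul_comm, Complex.mul_conj, Complex.normSq_eq_norm_sq, hzr]
      push_cast
      rfl
    simp only [Pi.add_apply, hGH z (hsph hz), mul_add, smul_eq_mul]
    congr 1
    · rw [h1]
      ring
    · simp
  rw [Real.circleAverage_congr_sphere hcong, Real.circleAverage_add,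
    Real.circleAverage_fun_smul]
  · have h2 := Complex.conjCLE.toContinuousLinearMap.circleAverage_comp_comm
      (hcH.circleIntegrable')
    have h3 : Real.circleAverage (fun z => Complex.conjCLE (z ^ k * H z)) 0 r = 0 := by
      refine h2.trans ?_
      rw [hH0, map_zero]
    rw [h3, add_zero, smul_eq_mul]
    congr 1
    rcases le_total r (1 / 2) with h4 | h4
    · exact (hindep r (1 / 2) hr.1 h4 (by norm_num)).symm
    · exact hindep (1 / 2) r (by norm_num) h4 hr.2
  · exact (continuousOn_const.mul hcG).circleIntegrable'
  · exact (Complex.conjCLE.continuous.comp_continuousOn hcH).circleIntegrable'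

/-! ### The disk measure in polar coordinates -/

/-- An identity of measures transfers integrability as well as integrals, which allows polar
coordinates for symbols that are merely measurable. -/
theorem diskMeasure_eq_map_circleMap :
    diskMeasure = Measure.map (fun q : ℝ × ℝ => circleMap 0 q.1 q.2)
      ((volume.restrict (Set.Ioo (0 : ℝ) 1 ×ˢ Set.Ioo (-Real.pi) Real.pi)).withDensity
        fun q => ENNReal.ofReal (Real.pi⁻¹ * q.1)) := by
  have hcm : Measurable (fun q : ℝ × ℝ => circleMap 0 q.1 q.2) := by
    unfold circleMap; fun_prop
  have hsymm : ∀ p : ℝ × ℝ, Complex.polarCoord.symm p = circleMap 0 p.1 p.2 := by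
    intro p
    rw [Complex.polarCoord_symm_apply, circleMap, Complex.exp_mul_I]
    simp
  refine Measure.ext_of_lintegral _ fun f hf => ?_
  rw [lintegral_map hf hcm, lintegral_withDensity_eq_lintegral_mul _ (by fun_prop)
      (show Measurable fun q : ℝ × ℝ => f (circleMap 0 q.1 q.2) from hf.comp hcm),
    diskMeasure, lintegral_smul_measure, ← lintegral_indicator measurableSet_ball,
    ← Complex.lintegral_comp_polarCoord_symm, smul_eq_mul,
    ← lintegral_const_mul' _ _ ENNReal.ofReal_ne_top,
    ← lintegral_indicator polarCoord.open_target.measurableSet,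
    ← lintegral_indicator (measurableSet_Ioo.prod measurableSet_Ioo)]
  congr 1
  ext q
  by_cases hq : q ∈ polarCoord.target
  · have hq0 : 0 < q.1 := hq.1
    rw [Set.indicator_of_mem hq, hsymm]
    by_cases hq1 : q.1 < 1
    · have hq' : q ∈ Set.Ioo (0 : ℝ) 1 ×ˢ Set.Ioo (-Real.pi) Real.pi := ⟨⟨hq0, hq1⟩, hq.2⟩
      rw [Set.indicator_of_mem hq', Set.indicator_of_mem (by simpa [abs_of_pos hq0] using hq1)]
      simp only [Pi.mul_apply, smul_eq_mul]
      rw [← mul_assoc, ← ENNReal.ofReal_mul (by positivity)]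
    · rw [Set.indicator_of_notMem (by simpa [abs_of_pos hq0] using hq1),
        Set.indicator_of_notMem (fun h => hq1 h.1.2)]
      simp
  · rw [Set.indicator_of_notMem hq, Set.indicator_of_notMem]
    exact fun h => hq ⟨h.1.1, h.2⟩

theorem integral_diskMeasure_eq_circleAverage {g : ℂ → ℂ} (hg : Integrable g diskMeasure) :
    ∫ z, g z ∂diskMeasure = ∫ r in Set.Ioo (0 : ℝ) 1, (2 * r) • Real.circleAverage g 0 r := by
  have hcm : Measurable (fun q : ℝ × ℝ => circleMap 0 q.1 q.2) := by
    unfold circleMap; fun_prop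
  have hdm : Measurable fun q : ℝ × ℝ => ENNReal.ofReal (Real.pi⁻¹ * q.1) := by fun_prop
  rw [diskMeasure_eq_map_circleMap] at hg ⊢
  rw [integral_map hcm.aemeasurable hg.aestronglyMeasurable,
    integral_withDensity_eq_integral_toReal_smul hdm (by simp)]
  rw [integrable_map_measure hg.aestronglyMeasurable hcm.aemeasurable,
    integrable_withDensity_iff_integrable_smul' hdm (by simp)] at hg
  rw [Measure.volume_eq_prod] at hg ⊢
  simp only [Function.comp_apply] at hg
  rw [setIntegral_prod _ hg]
  refine setIntegral_congr_fun measurableSet_Ioo fun r hr => ?_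
  have hr0 : 0 < r := hr.1
  have e : (ENNReal.ofReal (Real.pi⁻¹ * r)).toReal = Real.pi⁻¹ * r :=
    ENNReal.toReal_ofReal (by positivity)
  simp only [e]
  rw [integral_smul, Real.circleAverage_eq_integral_add (-Real.pi),
    intervalIntegral.integral_comp_add_right (fun θ => g (circleMap 0 r θ)), smul_smul,
    ← integral_Ioc_eq_integral_Ioo, ← intervalIntegral.integral_of_le (by linarith [Real.pi_pos])]
  have : 2 * Real.pi + -Real.pi = Real.pi := by ring
  rw [this, zero_add]
  congr 1
  have := Real.pi_pos
  field_simp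

/-! ### Toeplitz operators on the powers of z -/

theorem quasihomogeneous_natCast (p : ℕ) (φ : ℝ → ℂ) {z : ℂ} (hz : z ≠ 0) :
    quasihomogeneous p φ z = (z / ‖z‖) ^ p * φ ‖z‖ := by
  have h1 : z / ‖z‖ = Complex.exp (Complex.arg z * Complex.I) := by
    rw [div_eq_iff (by simpa using hz), mul_comm]
    exact (Complex.norm_mul_exp_arg_mul_I z).symm
  rw [quasihomogeneous, h1, ← Complex.exp_nat_mul]
  congr 2
  push_cast
  ring

theorem memLp_pow_disk (n : ℕ) : MemLp (fun z : ℂ => z ^ n) 2 diskMeasure := by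
  refine MemLp.of_bound (C := 1) (by fun_prop) ?_
  filter_upwards [diskMeasure_ae_mem] with z hz
  rw [norm_pow]
  exact pow_le_one₀ (norm_nonneg _) (mem_ball_zero_iff.1 hz).le

/-- The monomial `z ^ n` as an element of the harmonic Bergman space. -/
noncomputable def bergmanMonomial (n : ℕ) : harmonicBergman :=
  ⟨(memLp_pow_disk n).toLp _, fun z => z ^ n,
    fun _ _ => (analyticAt_id.pow n).harmonicAt, (memLp_pow_disk n).coeFn_toLp⟩

theorem bergmanMonomial_coeFn (n : ℕ) :
    ((bergmanMonomial n : Lp ℂ 2 diskMeasure) : ℂ → ℂ) =ᵐ[diskMeasure] fun z => z ^ n :=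
  (memLp_pow_disk n).coeFn_toLp

theorem diskMeasure_ne_zero : diskMeasure ≠ 0 := by
  intro h
  have h1 : diskMeasure (ball 0 1) = 0 := by rw [h]; rfl
  rw [diskMeasure, Measure.smul_apply, Measure.restrict_apply_self, smul_eq_mul, mul_eq_zero] at h1
  rcases h1 with h1 | h1
  · exact absurd (ENNReal.ofReal_eq_zero.1 h1) (not_le.2 (inv_pos.2 Real.pi_pos))
  · exact (measure_ball_pos volume (0 : ℂ) one_pos).ne' h1

theorem diskMeasure_ae_ne_zero : ∀ᵐ z ∂diskMeasure, z ≠ 0 := by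
  refine Measure.ae_smul_measure (ae_restrict_of_ae ?_) _
  exact Measure.ae_ne volume 0

theorem bergmanMonomial_ne_zero (n : ℕ) : bergmanMonomial n ≠ 0 := by
  intro h
  have h1 : ((bergmanMonomial n : Lp ℂ 2 diskMeasure) : ℂ → ℂ) =ᵐ[diskMeasure] 0 := by
    rw [h]
    exact Lp.coeFn_zero ℂ 2 diskMeasure
  have h2 : ∀ᵐ z ∂diskMeasure, False := by
    filter_upwards [h1, bergmanMonomial_coeFn n, diskMeasure_ae_ne_zero] with z a b c
    rw [a] at b
    exact pow_ne_zero n c b.symm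
  exact diskMeasure_ne_zero (by simpa using h2)

theorem powerMoment_one (n : ℕ) : powerMoment (fun _ => 1) (n : ℂ) = 1 / (n + 1) := by
  rw [powerMoment_natCast]
  simp only [mul_one]
  rw [integral_complex_ofReal, ← integral_Ioc_eq_integral_Ioo,
    ← intervalIntegral.integral_of_le zero_le_one, integral_pow]
  simp

/-- The product of the symbol and z^n has angular frequency n + p, so it pairs with a harmonic
function only through that function's Fourier coefficient of order n + p. Its projection is thus a
multiple of z^(n+p), and the scalar is fixed by orthogonality of the remainder. -/
theorem toeplitz_bergmanMonomial {p : ℕ} (hp : 0 < p) (φ : ℝ → ℂ)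
    (hφ : MemLp φ ∞ (volume.restrict (Set.Ioo (0 : ℝ) 1))) (n : ℕ) :
    toeplitz (quasihomogeneous p φ) (memLp_quasihomogeneous p hφ) (bergmanMonomial n) =
      ((2 * (n + p : ℕ) + 2 : ℂ) * powerMoment φ ((2 * n + p + 1 : ℕ) : ℂ)) •
        bergmanMonomial (n + p) := by
  have hφ1 : IntegrableOn φ (Set.Ioo 0 1) := hφ.integrable (by simp)
  set k := n + p with hk
  set c : ℂ := (2 * (k : ℕ) + 2 : ℂ) * powerMoment φ ((2 * n + p + 1 : ℕ) : ℂ) with hc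
  set V : Lp ℂ 2 diskMeasure := ((ContinuousLinearMap.mul ℂ ℂ).holderL diskMeasure ∞ 2 2
    ((memLp_quasihomogeneous p hφ).toLp _)) (bergmanMonomial n) with hV
  have hVae : (V : ℂ → ℂ) =ᵐ[diskMeasure] fun z => quasihomogeneous p φ z * z ^ n := by
    rw [hV, ContinuousLinearMap.holderL_apply_apply]
    filter_upwards [ContinuousLinearMap.coeFn_holder (r := 2) (ContinuousLinearMap.mul ℂ ℂ)
      ((memLp_quasihomogeneous p hφ).toLp _) (bergmanMonomial n : Lp ℂ 2 diskMeasure),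
      (memLp_quasihomogeneous p hφ).coeFn_toLp, bergmanMonomial_coeFn n] with z h1 h2 h3
    rw [h1, h2, h3]
    rfl
  set W : harmonicBergman := c • bergmanMonomial k with hW
  have hWae : ((W : Lp ℂ 2 diskMeasure) : ℂ → ℂ) =ᵐ[diskMeasure] fun z => c * z ^ k := by
    have h1 : (W : Lp ℂ 2 diskMeasure) = c • (bergmanMonomial k : Lp ℂ 2 diskMeasure) := rfl
    rw [h1]
    filter_upwards [Lp.coeFn_smul c (bergmanMonomial k : Lp ℂ 2 diskMeasure),
      bergmanMonomial_coeFn k] with z h2 h3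
    rw [h2, Pi.smul_apply, h3, smul_eq_mul]
  have hperp : V - (W : Lp ℂ 2 diskMeasure) ∈ harmonicBergmanᗮ := by
    rw [Submodule.mem_orthogonal]
    rintro u ⟨h, hh, hu⟩
    set g : ℂ → ℂ := fun z => (quasihomogeneous p φ z * z ^ n - c * z ^ k) * conj (h z) with hg
    have hae : (fun z => inner ℂ (u z) ((V - (W : Lp ℂ 2 diskMeasure) : Lp ℂ 2 diskMeasure) z))
        =ᵐ[diskMeasure] g := by
      filter_upwards [hu, hVae, hWae, Lp.coeFn_sub V (W : Lp ℂ 2 diskMeasure)] with z h1 h2 h3 h4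
      rw [h4, Pi.sub_apply, h1, h2, h3]
      rfl
    have hgi : Integrable g diskMeasure := (L2.integrable_inner u _).congr hae
    obtain ⟨C, hC⟩ := exists_circleAverage_conj_pow_mul hh (k := k) (by omega)
    rw [L2.inner_def, integral_congr_ae hae, integral_diskMeasure_eq_circleAverage hgi]
    -- On each circle g is a scalar times the conjugate of conj z^k h, so the dependence on h enters
    -- only through the constant C.
    have hcirc : ∀ r ∈ Set.Ioo (0 : ℝ) 1, (2 * r) • Real.circleAverage g 0 r =
        2 * conj C * (((r : ℂ) ^ ((2 * n + p + 1 : ℕ) : ℂ)) * φ r -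
          c * ((r : ℂ) ^ ((2 * k + 1 : ℕ) : ℂ) * 1)) := by
      intro r hr
      have hr0 : (r : ℂ) ≠ 0 := Complex.ofReal_ne_zero.2 hr.1.ne'
      have hcong : Set.EqOn g (fun z => (φ r / (r : ℂ) ^ p - c) •
          Complex.conjCLE (conj z ^ k * h z)) (sphere 0 |r|) := by
        intro z hz
        rw [abs_of_pos hr.1, mem_sphere_zero_iff_norm] at hz
        have hz0 : z ≠ 0 := by
          rw [← norm_pos_iff, hz]
          exact hr.1
        simp only [hg, quasihomogeneous_natCast p φ hz0, hz, div_pow, smul_eq_mul, Complex.conjCLE_apply,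
          map_mul, map_pow, Complex.conj_conj, hk]
        field_simp
        ring
      have hcont : ContinuousOn (fun z => conj z ^ k * h z) (sphere 0 |r|) := by
        rw [abs_of_pos hr.1]
        have := hh.contDiffOn.continuousOn.mono
          (sphere_subset_closedBall.trans (closedBall_subset_ball hr.2))
        have hconj : Continuous fun z : ℂ => conj z ^ k := by fun_prop
        exact hconj.continuousOn.mul this
      have h2 := Complex.conjCLE.toContinuousLinearMap.circleAverage_comp_comm
        (hcont.circleIntegrable')
      have h3 : Real.circleAverage (fun z => Complex.conjCLE (conj z ^ k * h z)) 0 r =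
          (r : ℂ) ^ (2 * k) * conj C := by
        refine h2.trans ?_
        rw [hC r hr]
        simp
      rw [Real.circleAverage_congr_sphere hcong, Real.circleAverage_fun_smul, h3, smul_eq_mul,
        Complex.real_smul, Complex.cpow_natCast, Complex.cpow_natCast, hk]
      push_cast
      field_simp
      ring
    have hi1 := integrable_cpow_mul hφ1 (ζ := ((2 * n + p + 1 : ℕ) : ℂ))
      (by rw [Complex.natCast_re]; positivity)
    have hi2 := integrable_cpow_mul (f := fun _ => 1) (by simp [IntegrableOn])
      (ζ := ((2 * k + 1 : ℕ) : ℂ)) (by rw [Complex.natCast_re]; positivity)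
    rw [setIntegral_congr_fun measurableSet_Ioo hcirc, integral_const_mul,
      integral_sub hi1 (hi2.const_mul c), integral_const_mul]
    -- The moment of 1 at 2k + 1 is 1/(2k + 2); the factor 2k + 2 in c cancels it.
    have h4 := powerMoment_one (2 * k + 1)
    rw [powerMoment] at h4
    rw [h4, hc, powerMoment]
    have h5 : (2 * (k : ℂ) + 2) ≠ 0 := by exact_mod_cast (by omega : 2 * k + 2 ≠ 0)
    have h6 : (((2 * k + 1 : ℕ) : ℂ) + 1) = 2 * (k : ℂ) + 2 := by push_cast; ring
    rw [h6]
    field_simp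
    ring
  have hproj : toeplitz (quasihomogeneous p φ) (memLp_quasihomogeneous p hφ) (bergmanMonomial n) =
      harmonicBergman.orthogonalProjectionOnto V := rfl
  have hsplit : V = (V - (W : Lp ℂ 2 diskMeasure)) + W := by abel
  rw [hproj, hsplit, map_add, Submodule.orthogonalProjectionOnto_apply_of_mem_orthogonal hperp,
    Submodule.orthogonalProjectionOnto_mem_subspace_eq_self, zero_add]

/-! ### Commuting operators and the uniqueness theorem -/

/-- Both compositions send z^n to a multiple of z^(n+p+s). The outer operator contributes the same
factor 2(n+p+s) + 2 in either order, and it cancels. -/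
theorem powerMoment_relation_of_commute {p s : ℕ} (hp : 0 < p) (hs : 0 < s) {φ ψ : ℝ → ℂ}
    (hφ : MemLp φ ∞ (volume.restrict (Set.Ioo (0 : ℝ) 1)))
    (hψ : MemLp ψ ∞ (volume.restrict (Set.Ioo (0 : ℝ) 1)))
    (hcomm : Commute (toeplitz (quasihomogeneous s ψ) (memLp_quasihomogeneous s hψ))
      (toeplitz (quasihomogeneous p φ) (memLp_quasihomogeneous p hφ))) (n : ℕ) :
    ((n + p : ℕ) + 1 : ℂ) * powerMoment φ ((2 * n + p + 1 : ℕ) : ℂ) *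
        powerMoment ψ ((2 * (n + p) + s + 1 : ℕ) : ℂ) =
      ((n + s : ℕ) + 1 : ℂ) * powerMoment ψ ((2 * n + s + 1 : ℕ) : ℂ) *
        powerMoment φ ((2 * (n + s) + p + 1 : ℕ) : ℂ) := by
  have h : toeplitz (quasihomogeneous s ψ) (memLp_quasihomogeneous s hψ)
        (toeplitz (quasihomogeneous p φ) (memLp_quasihomogeneous p hφ) (bergmanMonomial n)) =
      toeplitz (quasihomogeneous p φ) (memLp_quasihomogeneous p hφ)
        (toeplitz (quasihomogeneous s ψ) (memLp_quasihomogeneous s hψ) (bergmanMonomial n)) :=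
    congrArg (fun A => A (bergmanMonomial n)) hcomm.eq
  rw [toeplitz_bergmanMonomial hp φ hφ, toeplitz_bergmanMonomial hs ψ hψ, map_smul, map_smul,
    toeplitz_bergmanMonomial hp φ hφ, toeplitz_bergmanMonomial hs ψ hψ, smul_smul, smul_smul] at h
  rw [show n + s + p = n + p + s by ring] at h
  have h1 := smul_left_injective ℂ (bergmanMonomial_ne_zero (n + p + s)) h
  have h2 : (2 * ((n + p + s : ℕ) : ℂ) + 2) ≠ 0 := by
    exact_mod_cast (by omega : 2 * (n + p + s) + 2 ≠ 0)
  refine mul_left_cancel₀ (mul_ne_zero two_ne_zero h2) ?_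
  linear_combination h1

theorem theorem4 (p s : ℕ) (hp : 0 < p) (hs : 0 < s)
    (φ : ℝ → ℂ) (hφ : MemLp φ ∞ (volume.restrict (Set.Ioo (0 : ℝ) 1)))
    (hφc : ¬ ∃ c : ℂ, φ =ᵐ[volume.restrict (Set.Ioo (0 : ℝ) 1)] fun _ => c)
    (ψ₁ ψ₂ : ℝ → ℂ)
    (hψ₁ : MemLp ψ₁ ∞ (volume.restrict (Set.Ioo (0 : ℝ) 1)))
    (hψ₂ : MemLp ψ₂ ∞ (volume.restrict (Set.Ioo (0 : ℝ) 1)))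
    (hcomm₁ : Commute (toeplitz (quasihomogeneous s ψ₁) (memLp_quasihomogeneous s hψ₁))
      (toeplitz (quasihomogeneous p φ) (memLp_quasihomogeneous p hφ)))
    (hcomm₂ : Commute (toeplitz (quasihomogeneous s ψ₂) (memLp_quasihomogeneous s hψ₂))
      (toeplitz (quasihomogeneous p φ) (memLp_quasihomogeneous p hφ)))
    (hψ₂0 : ¬ ψ₂ =ᵐ[volume.restrict (Set.Ioo (0 : ℝ) 1)] 0) :
    ∃ c : ℂ, ψ₁ =ᵐ[volume.restrict (Set.Ioo (0 : ℝ) 1)] fun r => c * ψ₂ r := by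
  have hφi : IntegrableOn φ (Set.Ioo 0 1) := hφ.integrable (by simp)
  have hψ₁i : IntegrableOn ψ₁ (Set.Ioo 0 1) := hψ₁.integrable (by simp)
  have hψ₂i : IntegrableOn ψ₂ (Set.Ioo 0 1) := hψ₂.integrable (by simp)
  have hmem : ∀ᵐ r : ℝ ∂(volume.restrict (Set.Ioo (0 : ℝ) 1)), (r : ℂ) ≠ 0 := by
    filter_upwards [ae_restrict_mem measurableSet_Ioo] with r hr
    exact Complex.ofReal_ne_zero.2 hr.1.ne'
  -- Absorbing r^p and r^s shifts the arguments so that every transform is read off the same odd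
  -- integer 2n + 1, up to the common shift 2p.
  set u : ℝ → ℂ := fun r => (r : ℂ) ^ p * φ r with hu
  set g₁ : ℝ → ℂ := fun r => (r : ℂ) ^ s * ψ₁ r with hg₁
  set g₂ : ℝ → ℂ := fun r => (r : ℂ) ^ s * ψ₂ r with hg₂
  have hui : IntegrableOn u (Set.Ioo 0 1) := integrableOn_pow_mul hφi p
  have hg₁i : IntegrableOn g₁ (Set.Ioo 0 1) := integrableOn_pow_mul hψ₁i s
  have hg₂i : IntegrableOn g₂ (Set.Ioo 0 1) := integrableOn_pow_mul hψ₂i s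
  have hG₁i := integrableOn_pow_mul hg₁i (2 * p)
  have hG₂i := integrableOn_pow_mul hg₂i (2 * p)
  have hzero : ∀ ζ : ℂ, 0 < ζ.re → powerMoment u ζ *
      (powerMoment g₁ (ζ + (2 * p : ℕ)) * powerMoment g₂ ζ -
        powerMoment g₂ (ζ + (2 * p : ℕ)) * powerMoment g₁ ζ) = 0 := by
    intro ζ hζ
    rw [← powerMoment_pow_mul g₁, ← powerMoment_pow_mul g₂]
    refine powerMoment_mul_sub_eq_zero hui hG₁i hg₁i hG₂i hg₂i (fun n => ?_) hζ
    simp only [powerMoment_pow_mul, hu, hg₁, hg₂]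
    have e₁ := powerMoment_relation_of_commute hp hs hφ hψ₁ hcomm₁ n
    have e₂ := powerMoment_relation_of_commute hp hs hφ hψ₂ hcomm₂ n
    have a1 : ((2 * n + 1 : ℕ) : ℂ) + p = ((2 * n + p + 1 : ℕ) : ℂ) := by push_cast; ring
    have a2 : ((2 * n + 1 : ℕ) : ℂ) + s = ((2 * n + s + 1 : ℕ) : ℂ) := by push_cast; ring
    have a3 : ((2 * n + 1 : ℕ) : ℂ) + (2 * p : ℕ) + s = ((2 * (n + p) + s + 1 : ℕ) : ℂ) := by
      push_cast; ring
    rw [a1, a2, a3]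
    have hne : ((n + p : ℕ) + 1 : ℂ) ≠ 0 := Nat.cast_add_one_ne_zero _
    refine (mul_eq_zero.1 ?_).resolve_left hne
    -- Cross-multiplication removes the moment of φ at 2(n + s) + p + 1, which occurs in both
    -- relations.
    linear_combination powerMoment ψ₂ ((2 * n + s + 1 : ℕ) : ℂ) * e₁ -
      powerMoment ψ₁ ((2 * n + s + 1 : ℕ) : ℂ) * e₂
  have hshift : ∀ f : ℝ → ℂ, IntegrableOn f (Set.Ioo 0 1) →
      AnalyticOnNhd ℂ (fun ζ => powerMoment f (ζ + (2 * p : ℕ))) {ζ | 0 < ζ.re} := by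
    intro f hf
    simp only [← powerMoment_pow_mul]
    exact analyticOnNhd_powerMoment (integrableOn_pow_mul hf (2 * p))
  have hper : ∀ ζ : ℂ, 0 < ζ.re → powerMoment g₁ (ζ + (2 * p : ℕ)) * powerMoment g₂ ζ =
      powerMoment g₂ (ζ + (2 * p : ℕ)) * powerMoment g₁ ζ := by
    rcases (analyticOnNhd_powerMoment hui).eq_zero_or_eq_zero_of_mul_eq_zero
      (((hshift _ hg₁i).mul (analyticOnNhd_powerMoment hg₂i)).sub
        ((hshift _ hg₂i).mul (analyticOnNhd_powerMoment hg₁i)))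
      hzero isPreconnected_re_pos with h | h
    · refine absurd ⟨0, ?_⟩ hφc
      have h0 : u =ᵐ[volume.restrict (Set.Ioo (0 : ℝ) 1)] 0 := by
        refine ae_eq_zero_of_powerMoment_eq_zero (m := 1) (d := 1) hui one_pos fun k => ?_
        exact h _ (by rw [Set.mem_ofPred_eq, Complex.natCast_re]; positivity)
      filter_upwards [h0, hmem] with r h1 h2
      exact (mul_eq_zero.1 h1).resolve_left (pow_ne_zero _ h2)
    · exact fun ζ hζ => sub_eq_zero.1 (h ζ hζ)
  obtain ⟨c, hc⟩ := ae_eq_const_mul_of_powerMoment_periodic hg₁i hg₂i (d := 2 * p) (by omega) hper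
    (fun h => hψ₂0 (by
      filter_upwards [h, hmem] with r h1 h2
      exact (mul_eq_zero.1 h1).resolve_left (pow_ne_zero _ h2)))
  refine ⟨c, ?_⟩
  filter_upwards [hc, hmem] with r h1 h2
  refine mul_left_cancel₀ (pow_ne_zero s h2) ?_
  simp only [hg₁, hg₂] at h1
  rw [h1]
  ring
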